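/- Let $s(n,k)$ ($n\ge 1$, $k\in\mathbb Z$) be Stern's array: $s(1,1)=1$, $s(1,k)=0$ for $k\neq 1$, and for $n\ge 2$, $s(n,2k)=s(n-1,k)$ and $s(n,2k+1)=s(n-1,k)+s(n-1,k+1)$. For $f:\mathbb R^2\to\mathbb R$ put $S_n(f)=\sum_{k=0}^{2^n-1} f\bigl(s(n,k),s(n,k+1)\bigr)$; the pairs $(s(n,k),s(n,k+1))$ for all other $k\in\mathbb Z$ are $(0,0)$, so if $f(0,0)=0$ this is the sum over all $k\in\mathbb Z$. For $r\ge 0$ of a fixed parity let $[a_1,a_2,a_3]_r$ denote the function of $r$ with period $6$ whose values are $a_1,a_2,a_3$ at $r=0,2,4$ (if $r$ is even) or at $r=1,3,5$ (if $r$ is odd). (1) Let $r$ be odd. There are an integer $\ell\ge 0$ with $\ell\le \frac r3+[\frac23,0,\frac13]_r$ and real constants $a_1,\dots,a_\ell$, depending only on $r$, such that for every real homogeneous polynomial $f(x,y)$ of degree $r$, $S_n(f)=\sum_{j=1}^{\ell}a_jS_{n-j}(f)$ for all sufficiently large $n$. (2) Let $r\ge 0$ be even. There are an integer $\ell\ge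 0$ with $\ell\le \frac r3+[4,\frac{10}3,\frac83]_r$ and real constants $a_1,\dots,a_\ell$, depending only on $r$, such that for every real homogeneous polynomial $f(x,y)$ of degree $r$, $S_n(f)=\sum_{j=1}^{\ell}a_jS_{n-j}(f)$ for all sufficiently large $n$. (3) Let $r\ge 0$ be even. There are an integer $\ell\ge 0$ with $\ell\le \frac r3+[2,\frac43,\frac23]_r$ and real constants $a_1,\dots,a_\ell$, depending only on $r$, such that for every real homogeneous polynomial $f(x,y)$ of degree $r$ there are real constants $b,c$ with $S_n(f)=\sum_{j=1}^{\ell}a_jS_{n-j}(f)+b+c(-1)^n$ for all sufficiently large $n$. -/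

import Mathlib

/-- Stern's array, with rows `n ≥ 1` and columns `k : ℤ`. There is no row `0`; the value there is a
placeholder. -/
def stern : ℕ → ℤ → ℕ
  | 0, _ => 0
  | 1, k => if k = 1 then 1 else 0
  | n + 2, k =>
    if Even k then stern (n + 1) (k / 2)
    else stern (n + 1) (k / 2) + stern (n + 1) (k / 2 + 1)

theorem stern_two_mul (n : ℕ) (k : ℤ) : stern (n + 2) (2 * k) = stern (n + 1) k := by
  simp [stern]

theorem stern_two_mul_add_one (n : ℕ) (k : ℤ) :
    stern (n + 2) (2 * k + 1) = stern (n + 1) k + stern (n + 1) (k + 1) := by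
  have h1 : ¬ Even (2 * k + 1) := by simp
  have h2 : (2 * k + 1) / 2 = k := by omega
  simp only [stern, if_neg h1, h2]

/-- The entries of row `n` outside columns `1, …, 2 ^ n - 1` vanish. -/
theorem stern_eq_zero (n : ℕ) (k : ℤ) (h : k ≤ 0 ∨ 2 ^ n ≤ k) : stern n k = 0 := by
  induction n using Nat.twoStepInduction generalizing k with
  | zero => rfl
  | one =>
    have : k ≠ 1 := by omega
    simp [stern, this]
  | more n _ ih =>
    rcases Int.even_or_odd' k with ⟨m, rfl | rfl⟩
    · rw [stern_two_mul]
      apply ih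
      rw [pow_succ] at h
      omega
    · rw [stern_two_mul_add_one, ih m, ih (m + 1)]
      all_goals
        rw [pow_succ] at h
        have : (2 : ℤ) ^ (n + 1) = 2 * 2 ^ n := by ring
        omega

/-- `S_n(f) = ∑_k f(s(n,k), s(n,k+1))`, over `0 ≤ k < 2 ^ n`. All other pairs of neighbours in row
`n` are `(0, 0)`, so for `f(0,0) = 0` this is the sum over all `k : ℤ`
(see `sternSum_eq_finsum`). -/
noncomputable def sternSum (n : ℕ) (f : ℝ → ℝ → ℝ) : ℝ :=
  ∑ k ∈ Finset.Ico (0 : ℤ) (2 ^ n), f (stern n k) (stern n (k + 1))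

theorem sternSum_eq_finsum (n : ℕ) (f : ℝ → ℝ → ℝ) (hf : f 0 0 = 0) :
    sternSum n f = ∑ᶠ k : ℤ, f (stern n k) (stern n (k + 1)) := by
  rw [sternSum, finsum_eq_sum_of_support_subset]
  intro k hk
  by_contra hk'
  apply hk
  simp only [Finset.coe_Ico, Set.mem_Ico, not_and_or, not_le, not_lt] at hk'
  show f (stern n k) (stern n (k + 1)) = 0
  rw [stern_eq_zero n k (by omega), stern_eq_zero n (k + 1) (by omega)]
  simpa using hf

/-- The polynomial function `(x, y) ↦ f(x, y)` of a bivariate real polynomial. -/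
noncomputable def polyFun (f : MvPolynomial (Fin 2) ℝ) (x y : ℝ) : ℝ :=
  MvPolynomial.eval ![x, y] f

/-- The periodic function `[a₁, …, a_p]_r`, for `r` restricted to one parity: it has period `2p`,
and `a₁, a₂, …` occur at `r = 0, 2, …` for even `r`, and at `r = 1, 3, …` for odd `r`. -/
def bracket {p : ℕ} [NeZero p] (a : Fin p → ℚ) (r : ℕ) : ℚ :=
  a (Fin.ofNat p (r / 2))

/-!
For `n ≥ 1`, `S_{n+1}(f) = S_n(Tf)` with `(Tf)(x, y) = f(x, x + y) + f(x + y, y)`, and `T`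
commutes with symmetrization, so `S_{n+1}(f)` is the value at `(0, 1)` of `T ^ n` applied to
`f(x, y) + f(y, x)`. Hence a polynomial that annihilates `T` on the symmetric forms of degree `r`
gives a recurrence.

Put `z = -(x + y)`, let `e₂, e₃` be the elementary symmetric functions of `x, y, z`, and let `Λ_r`
be the forms of degree `r` in `ℝ[e₂, e₃]`. If `r` is even and `g` is the symmetrization of
`x ^ i * y ^ j`, then `Tg + g` (for `i`, `j` even) or `Tg - g` (for `i`, `j` odd) is symmetric in
`x, y, z`, so `T ^ 2 - 1` maps the symmetric forms into `(T - 1)Λ_r + (T + 1)Λ_r`. If `r` is odd,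
`Tg` is a combination of the traceless parts of `z` and `z ^ 2` over `ℝ[e₂, e₃]`. Counting monomials
in `e₂, e₃` bounds the dimension of these images, hence the degree of the polynomial needed to
annihilate `T` on them.
-/

open Polynomial

section LinearAlgebra

/-- The coefficients `a₁, …, a_l` of the recurrence `u (n + l) = ∑ j, a_j * u (n + l - j)` with
characteristic polynomial `p`, monic of degree `l`. -/
noncomputable def recurrenceCoeff {R : Type*} [Ring R] (p : R[X]) (j : ℕ) : R :=
  -p.coeff (p.natDegree - j)

theorem pow_add_natDegree_eq_sum_add {R B : Type*} [CommRing R] [Ring B] [Algebra R B]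
    {p : R[X]} (hp : p.Monic) (t : B) (m : ℕ) :
    t ^ (m + p.natDegree) = ∑ j ∈ Finset.Icc 1 p.natDegree,
      recurrenceCoeff p j • t ^ (m + p.natDegree - j) + t ^ m * aeval t p := by
  have hsum : ∑ j ∈ Finset.Icc 1 p.natDegree, recurrenceCoeff p j • t ^ (m + p.natDegree - j) =
      -∑ i ∈ Finset.range p.natDegree, p.coeff i • t ^ (m + i) := by
    rw [← Finset.sum_neg_distrib]
    refine Finset.sum_nbij' (p.natDegree - ·) (p.natDegree - ·) ?_ ?_ ?_ ?_ ?_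
    all_goals
      intro j hj
      simp only [Finset.mem_Icc, Finset.mem_range] at hj ⊢
    any_goals omega
    rw [recurrenceCoeff, neg_smul, Nat.add_sub_assoc hj.2]
  rw [hsum, aeval_eq_sum_range, Finset.sum_range_succ, hp.coeff_natDegree, mul_add,
    Finset.mul_sum]
  simp only [mul_smul_comm, one_smul, ← pow_add, neg_add_cancel_left]

theorem coe_aeval_restrict {R E : Type*} [CommRing R] [AddCommGroup E] [Module R E]
    {T : Module.End R E} {W : Submodule R E} (hW : ∀ w ∈ W, T w ∈ W) (p : R[X]) (w : W) :
    (aeval (T.restrict hW) p w : E) = aeval T p w := by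
  simp only [aeval_eq_sum_range, LinearMap.sum_apply, LinearMap.smul_apply,
    Module.End.pow_restrict _ hW, LinearMap.restrict_apply, Submodule.coe_sum, Submodule.coe_smul]

variable {K E : Type*} [Field K] [AddCommGroup E] [Module K E] {T : Module.End K E}
  {W U : Submodule K E}

theorem exists_monic_aeval_eq_zero [FiniteDimensional K W] (hW : ∀ w ∈ W, T w ∈ W) :
    ∃ p : K[X], p.Monic ∧ p.natDegree = Module.finrank K W ∧ ∀ w ∈ W, aeval T p w = 0 := by
  refine ⟨(T.restrict hW).charpoly, LinearMap.charpoly_monic _, LinearMap.charpoly_natDegree _,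
    fun w hw ↦ ?_⟩
  rw [← coe_aeval_restrict hW _ ⟨w, hw⟩, LinearMap.aeval_self_charpoly]
  rfl

theorem exists_monic_aeval_mul_eq_zero [FiniteDimensional K U] (hW : ∀ w ∈ W, T w ∈ W) (q : K[X])
    (hU : W.map (aeval T q) ≤ U) :
    ∃ p : K[X], p.Monic ∧ p.natDegree ≤ Module.finrank K U ∧
      ∀ w ∈ W, aeval T (q * p) w = 0 := by
  have : FiniteDimensional K (W.map (aeval T q)) := Submodule.finiteDimensional_of_le hU
  have hcomm : Commute T (aeval T q) := by
    simpa only [aeval_X] using Commute.map (Commute.all X q) (aeval T)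
  have hinv : ∀ v ∈ W.map (aeval T q), T v ∈ W.map (aeval T q) := by
    rintro _ ⟨w, hw, rfl⟩
    exact ⟨T w, hW w hw, (LinearMap.congr_fun hcomm.eq w).symm⟩
  obtain ⟨p, hp, hdeg, hzero⟩ := exists_monic_aeval_eq_zero hinv
  refine ⟨p, hp, hdeg.trans_le (Submodule.finrank_mono hU), fun w hw ↦ ?_⟩
  rw [mul_comm, map_mul]
  exact hzero _ (Submodule.mem_map_of_mem hw)

end LinearAlgebra

section SymmetricFunctions

variable {A : Type*} [CommRing A]

/-- The second elementary symmetric function of `x, y, -(x + y)`. -/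
def elemTwo (x y : A) : A := -(x ^ 2 + x * y + y ^ 2)

/-- The third elementary symmetric function of `x, y, -(x + y)`. -/
def elemThree (x y : A) : A := -(x * y * (x + y))

/-- The `n`-th power sum of `x, y, -(x + y)`. -/
def powSum (x y : A) (n : ℕ) : A := x ^ n + y ^ n + (-(x + y)) ^ n

/-- The symmetrization of the monomial `x ^ i * y ^ j`. -/
def symmMonomial (x y : A) (i j : ℕ) : A := x ^ i * y ^ j + y ^ i * x ^ j

theorem symmMonomial_comm (x y : A) (i j : ℕ) : symmMonomial x y i j = symmMonomial x y j i := by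
  simp only [symmMonomial]
  ring

-- With `z = -(x + y)`, the three terms are the symmetrizations in the pairs of `x, y, z`, up to
-- the signs of the powers of `z`.
theorem symmMonomial_add_of_even {i j : ℕ} (hi : Even i) (hj : Even j) (x y : A) :
    symmMonomial x y i j + (symmMonomial x (x + y) i j + symmMonomial (x + y) y i j) =
      powSum x y i * powSum x y j - powSum x y (i + j) := by
  simp only [symmMonomial, powSum, hi.neg_pow, hj.neg_pow, (hi.add hj).neg_pow]
  ring

theorem symmMonomial_sub_of_odd {i j : ℕ} (hi : Odd i) (hj : Odd j) (x y : A) :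
    symmMonomial x y i j - (symmMonomial x (x + y) i j + symmMonomial (x + y) y i j) =
      powSum x y i * powSum x y j - powSum x y (i + j) := by
  simp only [symmMonomial, powSum, hi.neg_pow, hj.neg_pow, (hi.add_odd hj).neg_pow]
  ring

theorem symmMonomial_add_of_even_of_odd {i j : ℕ} (hi : Even i) (hj : Odd j) (x y : A) :
    symmMonomial x (x + y) i j + symmMonomial (x + y) y i j =
      (-(x + y)) ^ i * powSum x y j - (-(x + y)) ^ j * powSum x y i := by
  simp only [symmMonomial, powSum, hi.neg_pow, hj.neg_pow]
  ring

theorem powSum_add_three (x y : A) (n : ℕ) : powSum x y (n + 3) =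
    powSum x y n * elemThree x y - powSum x y (n + 1) * elemTwo x y := by
  simp only [powSum, elemTwo, elemThree]
  ring

theorem neg_add_pow_add_three (x y : A) (n : ℕ) : (-(x + y)) ^ (n + 3) =
    (-(x + y)) ^ n * elemThree x y - (-(x + y)) ^ (n + 1) * elemTwo x y := by
  simp only [elemTwo, elemThree]
  ring

/-- The pairs `(a, b)` with `2 * a + 3 * b + d = n`, exponents of `elemTwo ^ a * elemThree ^ b` in
the forms of degree `n` generated by a form of degree `d`. -/
def elemExponents (d n : ℕ) : Finset (ℕ × ℕ) :=
  (Finset.range (n + 1) ×ˢ Finset.range (n + 1)).filter fun e ↦ 2 * e.1 + 3 * e.2 + d = n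

theorem mem_elemExponents {d n : ℕ} {e : ℕ × ℕ} :
    e ∈ elemExponents d n ↔ 2 * e.1 + 3 * e.2 + d = n := by
  simp only [elemExponents, Finset.mem_filter, Finset.mem_product, Finset.mem_range,
    and_iff_right_iff_imp]
  omega

-- The exponent of `elemThree` has the parity of `n - d` and determines that of `elemTwo`.
theorem card_elemExponents_le {d n N : ℕ} (hN : ∀ a b, 2 * a + 3 * b + d = n → b < 2 * N) :
    (elemExponents d n).card ≤ N := by
  rw [← Finset.card_range N]
  refine Finset.card_le_card_of_injOn (fun e ↦ e.2 / 2) (fun e he ↦ ?_) fun e he e' he' h ↦ ?_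
  · have := hN _ _ (mem_elemExponents.mp he)
    simp only [Finset.coe_range, Set.mem_Iio]
    omega
  · have := mem_elemExponents.mp he
    have := mem_elemExponents.mp he'
    replace h : e.2 / 2 = e'.2 / 2 := h
    exact Prod.ext (by omega) (by omega)

section Span

variable (R : Type*) [CommRing R] [Algebra R A] (x y : A)

/-- The degree-`n` part of the module generated by `h`, regarded as homogeneous of degree `d`, over
the polynomials in `elemTwo x y` and `elemThree x y`. -/
def elemSpan (h : A) (d n : ℕ) : Submodule R A :=
  Submodule.span R
    ((fun e : ℕ × ℕ ↦ elemTwo x y ^ e.1 * elemThree x y ^ e.2 * h) '' elemExponents d n)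

instance finite_elemSpan (h : A) (d n : ℕ) : Module.Finite R (elemSpan R x y h d n) :=
  Module.Finite.span_of_finite R ((elemExponents d n).finite_toSet.image _)

theorem finrank_elemSpan_le [Nontrivial R] (h : A) (d n : ℕ) :
    Module.finrank R (elemSpan R x y h d n) ≤ (elemExponents d n).card := by
  classical
  rw [elemSpan, ← Finset.coe_image]
  exact (finrank_span_finset_le_card _).trans Finset.card_image_le

variable {x y}

theorem elemTwo_pow_mul_elemThree_pow_mul_mem {h : A} {d n : ℕ} (a b : ℕ)
    (hab : 2 * a + 3 * b + d = n) :
    elemTwo x y ^ a * elemThree x y ^ b * h ∈ elemSpan R x y h d n :=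
  Submodule.subset_span ⟨(a, b), mem_elemExponents.mpr hab, rfl⟩

variable {R}

theorem generator_mem_elemSpan {h : A} {d : ℕ} : h ∈ elemSpan R x y h d d := by
  simpa using elemTwo_pow_mul_elemThree_pow_mul_mem R (x := x) (y := y) (h := h) 0 0 (by simp)

theorem elemTwo_mem_elemSpan : elemTwo x y ∈ elemSpan R x y 1 0 2 := by
  simpa using elemTwo_pow_mul_elemThree_pow_mul_mem R (x := x) (y := y) (h := 1) 1 0 rfl

theorem elemThree_mem_elemSpan : elemThree x y ∈ elemSpan R x y 1 0 3 := by
  simpa using elemTwo_pow_mul_elemThree_pow_mul_mem R (x := x) (y := y) (h := 1) 0 1 rfl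

theorem elemSpan_mul_le (h : A) (d m n : ℕ) :
    elemSpan R x y h d m * elemSpan R x y 1 0 n ≤ elemSpan R x y h d (m + n) := by
  simp only [elemSpan, Submodule.span_mul_span]
  rw [← elemSpan, Submodule.span_le]
  rintro _ ⟨_, ⟨e, he, rfl⟩, _, ⟨e', he', rfl⟩, rfl⟩
  have hdeg := mem_elemExponents.mp he
  have hdeg' := mem_elemExponents.mp he'
  refine Submodule.subset_span ⟨e + e', mem_elemExponents.mpr ?_, ?_⟩
  · simp only [Prod.fst_add, Prod.snd_add]
    omega
  · simp only [Prod.fst_add, Prod.snd_add]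
    ring

theorem mem_of_cubic_recurrence {M : ℕ → Submodule R A}
    (hM : ∀ m n, M m * elemSpan R x y 1 0 n ≤ M (m + n)) {u : ℕ → A}
    (hu : ∀ n, u (n + 3) = u n * elemThree x y - u (n + 1) * elemTwo x y)
    (h0 : u 0 ∈ M 0) (h1 : u 1 ∈ M 1) (h2 : u 2 ∈ M 2) (n : ℕ) : u n ∈ M n := by
  induction n using Nat.strong_induction_on with
  | _ n ih =>
    match n, ih with
    | 0, _ => exact h0
    | 1, _ => exact h1
    | 2, _ => exact h2
    | n + 3, ih =>
      rw [hu]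
      exact sub_mem (hM n 3 (Submodule.mul_mem_mul (ih n (by omega)) elemThree_mem_elemSpan))
        (hM (n + 1) 2 (Submodule.mul_mem_mul (ih (n + 1) (by omega)) elemTwo_mem_elemSpan))

theorem powSum_mem_elemSpan (n : ℕ) : powSum x y n ∈ elemSpan R x y 1 0 n := by
  refine mem_of_cubic_recurrence (elemSpan_mul_le 1 0) (powSum_add_three x y) ?_ ?_ ?_ n
  · have h : powSum x y 0 = (3 : R) • (1 : A) := by
      simp only [powSum, pow_zero, ofNat_smul_eq_nsmul, nsmul_eq_mul]
      norm_num
    exact h ▸ Submodule.smul_mem _ _ generator_mem_elemSpan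
  · have h : powSum x y 1 = 0 := by
      simp only [powSum]
      ring
    exact h ▸ zero_mem _
  · have h : powSum x y 2 = (-2 : R) • elemTwo x y := by
      simp only [powSum, elemTwo, neg_smul, ofNat_smul_eq_nsmul, nsmul_eq_mul]
      push_cast
      ring
    exact h ▸ Submodule.smul_mem _ _ elemTwo_mem_elemSpan

theorem powSum_mul_powSum_sub_mem_elemSpan (i j : ℕ) :
    powSum x y i * powSum x y j - powSum x y (i + j) ∈ elemSpan R x y 1 0 (i + j) :=
  sub_mem (elemSpan_mul_le 1 0 i j
    (Submodule.mul_mem_mul (powSum_mem_elemSpan i) (powSum_mem_elemSpan j)))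
    (powSum_mem_elemSpan (i + j))

variable (R x y)

/-- The degree-`n` part of the module generated, over the polynomials in `elemTwo x y` and
`elemThree x y`, by `z = -(x + y)` and `3 * z ^ 2 - powSum x y 2`: combinations of powers of `z`
whose sum over `x, y, z` in place of `z` vanishes. -/
abbrev tracelessSpan (n : ℕ) : Submodule R A :=
  elemSpan R x y (-(x + y)) 1 n ⊔ elemSpan R x y (3 * (x + y) ^ 2 + 2 * elemTwo x y) 2 n

variable {R x y}

theorem tracelessSpan_mul_le (m n : ℕ) :
    tracelessSpan R x y m * elemSpan R x y 1 0 n ≤ tracelessSpan R x y (m + n) := by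
  rw [Submodule.sup_mul]
  exact sup_le_sup (elemSpan_mul_le _ 1 m n) (elemSpan_mul_le _ 2 m n)

theorem three_mul_neg_add_pow_sub_powSum_mem_tracelessSpan (n : ℕ) :
    3 * (-(x + y)) ^ n - powSum x y n ∈ tracelessSpan R x y n := by
  refine mem_of_cubic_recurrence (u := fun n ↦ 3 * (-(x + y)) ^ n - powSum x y n)
    tracelessSpan_mul_le (fun n ↦ ?_) ?_ ?_ ?_ n
  · simp only [neg_add_pow_add_three, powSum_add_three]
    ring
  · have h : 3 * (-(x + y)) ^ 0 - powSum x y 0 = 0 := by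
      simp only [powSum]
      ring
    exact h ▸ zero_mem _
  · have h : 3 * (-(x + y)) ^ 1 - powSum x y 1 = (3 : R) • -(x + y) := by
      simp only [powSum, ofNat_smul_eq_nsmul, nsmul_eq_mul]
      push_cast
      ring
    exact h ▸ Submodule.smul_mem _ _ (Submodule.mem_sup_left generator_mem_elemSpan)
  · have h : 3 * (-(x + y)) ^ 2 - powSum x y 2 = 3 * (x + y) ^ 2 + 2 * elemTwo x y := by
      simp only [powSum, elemTwo]
      ring
    exact h ▸ Submodule.mem_sup_right generator_mem_elemSpan

theorem neg_add_pow_mul_powSum_sub_mem_tracelessSpan (h3 : IsUnit (3 : R)) (i j : ℕ) :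
    (-(x + y)) ^ i * powSum x y j - (-(x + y)) ^ j * powSum x y i ∈
      tracelessSpan R x y (i + j) := by
  have hmem : ∀ i j, (3 * (-(x + y)) ^ i - powSum x y i) * powSum x y j ∈
      tracelessSpan R x y (i + j) := fun i j ↦
    tracelessSpan_mul_le i j (Submodule.mul_mem_mul
      (three_mul_neg_add_pow_sub_powSum_mem_tracelessSpan i) (powSum_mem_elemSpan j))
  rw [← Submodule.smul_mem_iff_of_isUnit _ h3]
  convert sub_mem (hmem i j) (add_comm j i ▸ hmem j i) using 1
  simp only [ofNat_smul_eq_nsmul, nsmul_eq_mul]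
  push_cast
  ring

end Span

end SymmetricFunctions

section SternOperator

variable {R : Type*} [CommRing R]

/-- The operator `(T f)(x, y) = f(x, x + y) + f(x + y, y)`, which expresses the sum over a row of
Stern's array as a sum over the preceding row. -/
def sternOp : Module.End R (R → R → R) where
  toFun f x y := f x (x + y) + f (x + y) y
  map_add' f g := by
    ext x y
    simp only [Pi.add_apply]
    ring
  map_smul' c f := by
    ext x y
    simp only [Pi.smul_apply, smul_eq_mul, RingHom.id_apply]
    ring

/-- The symmetrization `f(x, y) + f(y, x)`, as a linear map. -/
def symmetrize : Module.End R (R → R → R) where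
  toFun f x y := f x y + f y x
  map_add' f g := by
    ext x y
    simp only [Pi.add_apply]
    ring
  map_smul' c f := by
    ext x y
    simp only [Pi.smul_apply, smul_eq_mul, RingHom.id_apply]
    ring

theorem sternOp_apply (f : R → R → R) (x y : R) :
    sternOp f x y = f x (x + y) + f (x + y) y := rfl

theorem symmetrize_apply (f : R → R → R) (x y : R) : symmetrize f x y = f x y + f y x := rfl

theorem commute_sternOp_symmetrize : Commute (sternOp (R := R)) symmetrize := by
  ext f x y
  simp only [Module.End.mul_apply, sternOp_apply, symmetrize_apply, add_comm y x]
  ring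

/-- The first coordinate function on pairs. -/
def fstVar : R → R → R := fun x _ ↦ x

/-- The second coordinate function on pairs. -/
def sndVar : R → R → R := fun _ y ↦ y

variable (R) in
/-- The homogeneous polynomial functions of degree `r` in two variables. -/
def binaryForms (r : ℕ) : Submodule R (R → R → R) :=
  Submodule.span R {f | ∃ i j, i + j = r ∧ fstVar ^ i * sndVar ^ j = f}

variable (R) in
/-- The symmetrizations of the homogeneous polynomial functions of degree `r`. -/
def symmForms (r : ℕ) : Submodule R (R → R → R) := (binaryForms R r).map symmetrize

theorem sternOp_symmMonomial (i j : ℕ) :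
    sternOp (symmMonomial fstVar sndVar i j : R → R → R) =
      symmMonomial fstVar (fstVar + sndVar) i j + symmMonomial (fstVar + sndVar) sndVar i j := rfl

theorem map_symmForms_le {r : ℕ} {S : Module.End R (R → R → R)} {U : Submodule R (R → R → R)}
    (h : ∀ i j, i + j = r → S (symmMonomial fstVar sndVar i j) ∈ U) :
    (symmForms R r).map S ≤ U := by
  rw [symmForms, ← Submodule.map_comp, binaryForms, Submodule.map_span_le]
  rintro _ ⟨i, j, hij, rfl⟩
  exact h i j hij

theorem monomial_mem_binaryForms {r i j : ℕ} (h : i + j = r) :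
    (fstVar ^ i * sndVar ^ j : R → R → R) ∈ binaryForms R r :=
  Submodule.subset_span ⟨i, j, h, rfl⟩

theorem sternOp_mem_binaryForms {r : ℕ} {f : R → R → R} (hf : f ∈ binaryForms R r) :
    sternOp f ∈ binaryForms R r := by
  suffices h : (binaryForms R r).map sternOp ≤ binaryForms R r from h ⟨f, hf, rfl⟩
  rw [binaryForms, Submodule.map_span_le, ← binaryForms]
  rintro _ ⟨i, j, rfl, rfl⟩
  have hexpand : sternOp (fstVar ^ i * sndVar ^ j : R → R → R) =
      fstVar ^ i * (fstVar + sndVar) ^ j + (fstVar + sndVar) ^ i * sndVar ^ j := rfl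
  rw [hexpand, add_pow, add_pow, Finset.mul_sum, Finset.sum_mul]
  refine add_mem (sum_mem fun t ht ↦ ?_) (sum_mem fun t ht ↦ ?_) <;>
    have hle := Finset.mem_range_succ_iff.mp ht
  · convert Submodule.smul_mem _ (j.choose t : R)
      (monomial_mem_binaryForms (R := R) (show i + t + (j - t) = i + j by omega)) using 1
    rw [Nat.cast_smul_eq_nsmul, nsmul_eq_mul]
    ring
  · convert Submodule.smul_mem _ (i.choose t : R)
      (monomial_mem_binaryForms (R := R) (show t + (i - t + j) = i + j by omega)) using 1
    rw [Nat.cast_smul_eq_nsmul, nsmul_eq_mul]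
    ring

theorem sternOp_mem_symmForms {r : ℕ} {g : R → R → R} (hg : g ∈ symmForms R r) :
    sternOp g ∈ symmForms R r := by
  obtain ⟨f, hf, rfl⟩ := hg
  exact ⟨sternOp f, sternOp_mem_binaryForms hf,
    (LinearMap.congr_fun commute_sternOp_symmetrize.eq f).symm⟩

theorem map_sternOp_symmForms_le (h3 : IsUnit (3 : R)) {r : ℕ} (hr : Odd r) :
    (symmForms R r).map sternOp ≤ tracelessSpan R fstVar sndVar r := by
  have hmem : ∀ i j, Even i → Odd j →
      sternOp (symmMonomial fstVar sndVar i j : R → R → R) ∈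
        tracelessSpan R fstVar sndVar (i + j) := by
    intro i j hi hj
    rw [sternOp_symmMonomial, symmMonomial_add_of_even_of_odd hi hj]
    exact neg_add_pow_mul_powSum_sub_mem_tracelessSpan h3 i j
  refine map_symmForms_le ?_
  rintro i j rfl
  rcases Nat.even_or_odd i with hi | hi
  · exact hmem i j hi ((Nat.odd_add'.mp hr).mpr hi)
  · rw [symmMonomial_comm, add_comm]
    exact hmem j i ((Nat.odd_add.mp hr).mp hi) hi

theorem map_sternOp_sq_sub_one_symmForms_le {r : ℕ} (hr : Even r) :
    (symmForms R r).map (sternOp ^ 2 - 1 : Module.End R (R → R → R)) ≤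
      (elemSpan R fstVar sndVar 1 0 r).map (sternOp - 1) ⊔
        (elemSpan R fstVar sndVar 1 0 r).map (sternOp + 1) := by
  refine map_symmForms_le ?_
  rintro i j rfl
  set g : R → R → R := symmMonomial fstVar sndVar i j
  have hsq : (sternOp ^ 2 - 1 : Module.End R (R → R → R)) g = sternOp (sternOp g) - g := by
    rw [pow_two]
    rfl
  have hmem := powSum_mul_powSum_sub_mem_elemSpan (R := R) (A := R → R → R)
    (x := fstVar) (y := sndVar) i j
  rcases Nat.even_or_odd i with hi | hi
  · have hj : Even j := (Nat.even_add.mp hr).mp hi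
    rw [← symmMonomial_add_of_even hi hj, ← sternOp_symmMonomial] at hmem
    refine Submodule.mem_sup_left ⟨_, hmem, ?_⟩
    rw [hsq, LinearMap.sub_apply, Module.End.one_apply, map_add]
    abel
  · have hj : Odd j := (Nat.even_add'.mp hr).mp hi
    rw [← symmMonomial_sub_of_odd hi hj, ← sternOp_symmMonomial] at hmem
    refine Submodule.mem_sup_right ⟨_, neg_mem hmem, ?_⟩
    rw [hsq, LinearMap.add_apply, Module.End.one_apply, neg_sub, map_sub]
    abel

end SternOperator

section CharacteristicPolynomial

variable (K : Type*) [Field K]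

theorem exists_monic_aeval_sternOp_eq_zero_of_odd (h3 : (3 : K) ≠ 0) {r : ℕ} (hr : Odd r) :
    ∃ p : K[X], p.Monic ∧ p.natDegree ≤ (r + 5) / 6 + (r + 1) / 6 ∧
      ∀ g ∈ symmForms K r, aeval sternOp (X * p) g = 0 := by
  obtain ⟨p, hp, hdeg, hzero⟩ := exists_monic_aeval_mul_eq_zero
    (fun _ ↦ sternOp_mem_symmForms) X (U := tracelessSpan K fstVar sndVar r)
    (by simpa only [aeval_X] using map_sternOp_symmForms_le h3.isUnit hr)
  refine ⟨p, hp, hdeg.trans <| (Submodule.finrank_add_le_finrank_add_finrank _ _).trans <|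
    add_le_add ?_ ?_, hzero⟩ <;>
  · refine (finrank_elemSpan_le K _ _ _ _ _).trans (card_elemExponents_le fun a b hab ↦ ?_)
    obtain ⟨k, rfl⟩ := hr
    omega

theorem exists_monic_aeval_sternOp_eq_zero_of_even {r : ℕ} (hr : Even r) :
    ∃ p : K[X], p.Monic ∧ p.natDegree ≤ 2 * (r / 6 + 1) ∧
      ∀ g ∈ symmForms K r, aeval sternOp ((X ^ 2 - 1) * p) g = 0 := by
  obtain ⟨p, hp, hdeg, hzero⟩ := exists_monic_aeval_mul_eq_zero
    (fun _ ↦ sternOp_mem_symmForms) (X ^ 2 - 1) (by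
      simpa only [map_sub, aeval_X_pow, map_one] using
        map_sternOp_sq_sub_one_symmForms_le (R := K) hr)
  have hfinrank : Module.finrank K (elemSpan K (fstVar (R := K)) sndVar 1 0 r) ≤ r / 6 + 1 :=
    (finrank_elemSpan_le K _ _ _ _ _).trans (card_elemExponents_le (by omega))
  refine ⟨p, hp, ?_, hzero⟩
  calc p.natDegree ≤ _ := hdeg
    _ ≤ _ := Submodule.finrank_add_le_finrank_add_finrank _ _
    _ ≤ (r / 6 + 1) + (r / 6 + 1) := add_le_add ((Submodule.finrank_map_le _ _).trans hfinrank)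
        ((Submodule.finrank_map_le _ _).trans hfinrank)
    _ = 2 * (r / 6 + 1) := (two_mul _).symm

end CharacteristicPolynomial

section SternSum

theorem sum_range_two_mul {M : Type*} [AddCommMonoid M] (g : ℕ → M) (N : ℕ) :
    ∑ k ∈ Finset.range (2 * N), g k = ∑ k ∈ Finset.range N, (g (2 * k) + g (2 * k + 1)) := by
  induction N with
  | zero => rfl
  | succ N ih =>
    rw [mul_add_one, Finset.sum_range_succ, Finset.sum_range_succ, Finset.sum_range_succ, ih,
      add_assoc]

theorem sternSum_eq_sum_range (n : ℕ) (f : ℝ → ℝ → ℝ) :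
    sternSum n f = ∑ k ∈ Finset.range (2 ^ n), f (stern n k) (stern n (k + 1)) := by
  have htoNat : ((2 : ℤ) ^ n - 0).toNat = 2 ^ n := by
    rw [sub_zero]
    exact_mod_cast Int.toNat_natCast (2 ^ n)
  simp only [sternSum, Int.Ico_eq_finset_map, htoNat, Finset.sum_map,
    Function.Embedding.trans_apply, Nat.castEmbedding_apply, addLeftEmbedding_apply, zero_add]

theorem sternSum_add_two (n : ℕ) (f : ℝ → ℝ → ℝ) :
    sternSum (n + 2) f = sternSum (n + 1) (sternOp f) := by
  rw [sternSum_eq_sum_range, sternSum_eq_sum_range, pow_succ', sum_range_two_mul]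
  refine Finset.sum_congr rfl fun k _ ↦ ?_
  have hodd : 2 * (k : ℤ) + 1 + 1 = 2 * (k + 1) := by ring
  push_cast
  rw [hodd, stern_two_mul, stern_two_mul_add_one, stern_two_mul, sternOp_apply]
  push_cast
  rfl

theorem sternSum_add_one (n : ℕ) (f : ℝ → ℝ → ℝ) :
    sternSum (n + 1) f = (sternOp ^ n) (symmetrize f) 0 1 := by
  induction n generalizing f with
  | zero => simp [sternSum_eq_sum_range, Finset.sum_range_succ, stern, symmetrize_apply]
  | succ n ih =>
    rw [sternSum_add_two, ih, pow_succ, Module.End.mul_apply]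
    exact congrArg (fun g ↦ (sternOp ^ n) g 0 1)
      (LinearMap.congr_fun commute_sternOp_symmetrize.eq f).symm

theorem sternSum_eq_sum_add {p : ℝ[X]} (hp : p.Monic) (f : ℝ → ℝ → ℝ) (m : ℕ) :
    sternSum (p.natDegree + 1 + m) f =
      ∑ j ∈ Finset.Icc 1 p.natDegree,
        recurrenceCoeff p j * sternSum (p.natDegree + 1 + m - j) f +
      (sternOp ^ m) (aeval sternOp p (symmetrize f)) 0 1 := by
  have hindex : p.natDegree + 1 + m = m + p.natDegree + 1 := by omega
  rw [hindex, sternSum_add_one, pow_add_natDegree_eq_sum_add hp]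
  simp only [LinearMap.add_apply, LinearMap.sum_apply, LinearMap.smul_apply, Pi.add_apply,
    Finset.sum_apply, Pi.smul_apply, smul_eq_mul, Module.End.mul_apply]
  refine congrArg (· + _) (Finset.sum_congr rfl fun j hj ↦ ?_)
  have hle : j ≤ m + p.natDegree := le_add_left (Finset.mem_Icc.mp hj).2
  rw [← sternSum_add_one, Nat.sub_add_comm hle]

theorem eventually_sternSum_eq_sum {p : ℝ[X]} (hp : p.Monic) {f : ℝ → ℝ → ℝ} (k : ℕ)
    (hf : aeval sternOp (X ^ k * p) (symmetrize f) = 0) :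
    ∀ᶠ n : ℕ in Filter.atTop, sternSum n f =
      ∑ j ∈ Finset.Icc 1 p.natDegree, recurrenceCoeff p j * sternSum (n - j) f := by
  filter_upwards [Filter.eventually_ge_atTop (p.natDegree + 1 + k)] with n hn
  obtain ⟨m, rfl⟩ := Nat.exists_eq_add_of_le hn
  rw [map_mul, aeval_X_pow, Module.End.mul_apply] at hf
  rw [add_assoc _ k m, sternSum_eq_sum_add hp, add_comm k m, pow_add, Module.End.mul_apply, hf,
    map_zero, Pi.zero_apply, Pi.zero_apply, add_zero]

theorem exists_eq_add_mul_neg_one_pow {v : ℕ → ℝ} (hv : Function.Periodic v 2) (d : ℕ) :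
    ∃ b c : ℝ, ∀ m, v m = b + c * (-1) ^ (d + m) := by
  refine ⟨(v 0 + v 1) / 2, (v 0 - v 1) / 2 * (-1) ^ d, fun m ↦ ?_⟩
  rw [pow_add, mul_assoc, ← mul_assoc ((-1 : ℝ) ^ d), ← mul_pow, neg_one_mul, neg_neg, one_pow,
    one_mul]
  induction m using Nat.twoStepInduction with
  | zero => ring
  | one => ring
  | more m ih _ => rw [hv, ih, pow_add, neg_one_sq, mul_one]

theorem exists_eventually_sternSum_eq_sum_add {p : ℝ[X]} (hp : p.Monic) {f : ℝ → ℝ → ℝ}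
    (hf : aeval sternOp ((X ^ 2 - 1) * p) (symmetrize f) = 0) :
    ∃ b c : ℝ, ∀ᶠ n : ℕ in Filter.atTop, sternSum n f =
      ∑ j ∈ Finset.Icc 1 p.natDegree, recurrenceCoeff p j * sternSum (n - j) f +
        b + c * (-1) ^ n := by
  set w := aeval sternOp p (symmetrize f) with hw
  have hfix : (sternOp ^ 2) w = w := by
    rwa [map_mul, map_sub, aeval_X_pow, map_one, Module.End.mul_apply, LinearMap.sub_apply,
      Module.End.one_apply, sub_eq_zero] at hf
  have hperiodic : Function.Periodic (fun m ↦ (sternOp ^ m) w 0 1) 2 := fun m ↦ by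
    simp only [pow_add, Module.End.mul_apply, hfix]
  obtain ⟨b, c, hbc⟩ := exists_eq_add_mul_neg_one_pow hperiodic (p.natDegree + 1)
  refine ⟨b, c, ?_⟩
  filter_upwards [Filter.eventually_ge_atTop (p.natDegree + 1)] with n hn
  obtain ⟨m, rfl⟩ := Nat.exists_eq_add_of_le hn
  rw [sternSum_eq_sum_add hp, ← hw, hbc, ← add_assoc]

theorem polyFun_mem_binaryForms {r : ℕ} {f : MvPolynomial (Fin 2) ℝ} (hf : f.IsHomogeneous r) :
    polyFun f ∈ binaryForms ℝ r := by
  have hsum : polyFun f = ∑ d ∈ f.support, f.coeff d • (fstVar ^ d 0 * sndVar ^ d 1) := by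
    ext x y
    simp [polyFun, MvPolynomial.eval_eq', fstVar, sndVar]
  rw [hsum]
  refine sum_mem fun d hd ↦ Submodule.smul_mem _ _ (monomial_mem_binaryForms ?_)
  simpa [Finsupp.weight_apply, Finsupp.sum_fintype] using hf (MvPolynomial.mem_support_iff.mp hd)

theorem symmetrize_polyFun_mem_symmForms {r : ℕ} {f : MvPolynomial (Fin 2) ℝ}
    (hf : f.IsHomogeneous r) : symmetrize (polyFun f) ∈ symmForms ℝ r :=
  Submodule.mem_map_of_mem (polyFun_mem_binaryForms hf)

end SternSum

section Bracket

theorem bracket_periodic {p : ℕ} [NeZero p] (a : Fin p → ℚ) :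
    Function.Periodic (bracket a) (2 * p) := fun r ↦ by
  simp only [bracket, Nat.add_mul_div_left r p two_pos]
  exact congrArg a (Fin.ext (Nat.add_mod_right _ _))

theorem bracket_six_mul_add (a : Fin 3 → ℚ) (m k : ℕ) : bracket a (6 * m + k) = bracket a k := by
  rw [add_comm, mul_comm]
  exact (bracket_periodic a).nat_mul m k

theorem div_three_add_bracket_of_odd {r : ℕ} (hr : Odd r) :
    (r : ℚ) / 3 + bracket ![2 / 3, 0, 1 / 3] r = ((r + 5) / 6 + (r + 1) / 6 : ℕ) := by
  obtain ⟨m, rfl | rfl | rfl⟩ : ∃ m, r = 6 * m + 1 ∨ r = 6 * m + 3 ∨ r = 6 * m + 5 :=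
    ⟨r / 6, by obtain ⟨t, rfl⟩ := hr; omega⟩
  · have hdiv : (6 * m + 1 + 5) / 6 + (6 * m + 1 + 1) / 6 = 2 * m + 1 := by omega
    have hbracket : bracket ![2 / 3, 0, 1 / 3] 1 = 2 / 3 := rfl
    rw [hdiv, bracket_six_mul_add, hbracket]
    push_cast
    ring
  · have hdiv : (6 * m + 3 + 5) / 6 + (6 * m + 3 + 1) / 6 = 2 * m + 1 := by omega
    have hbracket : bracket ![2 / 3, 0, 1 / 3] 3 = 0 := rfl
    rw [hdiv, bracket_six_mul_add, hbracket]
    push_cast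
    ring
  · have hdiv : (6 * m + 5 + 5) / 6 + (6 * m + 5 + 1) / 6 = 2 * m + 2 := by omega
    have hbracket : bracket ![2 / 3, 0, 1 / 3] 5 = 1 / 3 := rfl
    rw [hdiv, bracket_six_mul_add, hbracket]
    push_cast
    ring

theorem div_three_add_bracket_of_even {r : ℕ} (hr : Even r) :
    (r : ℚ) / 3 + bracket ![2, 4 / 3, 2 / 3] r = (2 * (r / 6 + 1) : ℕ) := by
  obtain ⟨m, k, hk, rfl⟩ : ∃ m, ∃ k < 3, r = 6 * m + 2 * k :=
    ⟨r / 6, r / 2 % 3, by omega, by obtain ⟨t, rfl⟩ := hr; omega⟩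
  have hdiv : (6 * m + 2 * k) / 6 = m := by omega
  have hbracket : bracket ![2, 4 / 3, 2 / 3] (2 * k) = 2 - 2 * k / 3 := by
    interval_cases k <;> norm_num [bracket, Fin.ofNat]
  rw [hdiv, bracket_six_mul_add, hbracket]
  push_cast
  ring

theorem div_three_add_bracket_eq_add_two_of_even {r : ℕ} (hr : Even r) :
    (r : ℚ) / 3 + bracket ![4, 10 / 3, 8 / 3] r = (2 * (r / 6 + 1) + 2 : ℕ) := by
  have hshift : ![4, 10 / 3, 8 / 3] = fun i ↦ ![2, 4 / 3, 2 / 3] i + (2 : ℚ) := by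
    ext i
    fin_cases i <;> norm_num
  have hbracket : bracket ![4, 10 / 3, 8 / 3] r = bracket ![2, 4 / 3, 2 / 3] r + 2 :=
    congrArg (bracket · r) hshift
  rw [hbracket, ← add_assoc, div_three_add_bracket_of_even hr]
  push_cast
  rfl

end Bracket

theorem mainTheorem2 (r : ℕ) :
    (Odd r → ∃ (l : ℕ) (a : ℕ → ℝ),
      (l : ℚ) ≤ (r : ℚ) / 3 + bracket ![2 / 3, 0, 1 / 3] r ∧
      ∀ f : MvPolynomial (Fin 2) ℝ, f.IsHomogeneous r →
        ∀ᶠ n : ℕ in Filter.atTop,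
          sternSum n (polyFun f) =
            ∑ j ∈ Finset.Icc 1 l, a j * sternSum (n - j) (polyFun f)) ∧
    (Even r → ∃ (l : ℕ) (a : ℕ → ℝ),
      (l : ℚ) ≤ (r : ℚ) / 3 + bracket ![4, 10 / 3, 8 / 3] r ∧
      ∀ f : MvPolynomial (Fin 2) ℝ, f.IsHomogeneous r →
        ∀ᶠ n : ℕ in Filter.atTop,
          sternSum n (polyFun f) =
            ∑ j ∈ Finset.Icc 1 l, a j * sternSum (n - j) (polyFun f)) ∧
    (Even r → ∃ (l : ℕ) (a : ℕ → ℝ),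
      (l : ℚ) ≤ (r : ℚ) / 3 + bracket ![2, 4 / 3, 2 / 3] r ∧
      ∀ f : MvPolynomial (Fin 2) ℝ, f.IsHomogeneous r → ∃ b c : ℝ,
        ∀ᶠ n : ℕ in Filter.atTop,
          sternSum n (polyFun f) =
            (∑ j ∈ Finset.Icc 1 l, a j * sternSum (n - j) (polyFun f)) + b + c * (-1) ^ n) := by
  refine ⟨fun hr ↦ ?_, fun hr ↦ ?_, fun hr ↦ ?_⟩
  · obtain ⟨p, hp, hdeg, hzero⟩ := exists_monic_aeval_sternOp_eq_zero_of_odd ℝ three_ne_zero hr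
    refine ⟨p.natDegree, recurrenceCoeff p, ?_, fun f hf ↦ ?_⟩
    · rw [div_three_add_bracket_of_odd hr]
      exact_mod_cast hdeg
    · refine eventually_sternSum_eq_sum hp 1 ?_
      rw [pow_one]
      exact hzero _ (symmetrize_polyFun_mem_symmForms hf)
  · obtain ⟨p, hp, hdeg, hzero⟩ := exists_monic_aeval_sternOp_eq_zero_of_even ℝ hr
    have hq : (X ^ 2 - 1 : ℝ[X]).Monic := monic_X_pow_sub_C 1 two_ne_zero
    have hqdeg : (X ^ 2 - 1 : ℝ[X]).natDegree = 2 := natDegree_X_pow_sub_C (r := (1 : ℝ))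
    refine ⟨((X ^ 2 - 1) * p).natDegree, recurrenceCoeff ((X ^ 2 - 1) * p), ?_, fun f hf ↦ ?_⟩
    · rw [div_three_add_bracket_eq_add_two_of_even hr, hq.natDegree_mul hp, hqdeg, add_comm]
      exact_mod_cast Nat.add_le_add_right hdeg 2
    · refine eventually_sternSum_eq_sum (hq.mul hp) 0 ?_
      rw [pow_zero, one_mul]
      exact hzero _ (symmetrize_polyFun_mem_symmForms hf)
  · obtain ⟨p, hp, hdeg, hzero⟩ := exists_monic_aeval_sternOp_eq_zero_of_even ℝ hr
    refine ⟨p.natDegree, recurrenceCoeff p, ?_, fun f hf ↦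
      exists_eventually_sternSum_eq_sum_add hp (hzero _ (symmetrize_polyFun_mem_symmForms hf))⟩
    rw [div_three_add_bracket_of_even hr]
    exact_mod_cast hdeg
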